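/- Let $\Gamma$ be a finitely generated (discrete) group with a finite generating set $S$, and let $|g|_S$ be the word length of $g\in\Gamma$ with respect to $S\cup S^{-1}$. For functions $f,h:\Gamma\to[0,\infty)$ write $h\succ f$ if for every $\varepsilon>0$ there is a finite set $K\subset\Gamma$ such that $f(g)\le\varepsilon h(g)$ for all $g\notin K$. A Banach space $B$ (real or complex) is $p$-uniformly smooth, for $1<p\le 2$, if there is a constant $K$ such that for all $\tau>0$ $$\rho_B(\tau)=\sup\Big\{\tfrac{\|u+v\|+\|u-v\|}{2}-1 : u,v\in B,\ \|u\|\le 1,\ \|v\|\le\tau\Big\}\le K\tau^p .$$ A representation $\pi:\Gamma\to\mathrm{GL}(B)$ by invertible bounded linear operators is uniformly bounded if $\sup_{g\in\Gamma}\|\pi(g)\|<\infty$, and a cocycle with coefficients in $(\pi,B)$ is a map $b:\Gamma\to B$ with $b(gh)=b(g)+\pi(g)b(h)$ for all $g,h\in\Gamma$. The group $\Gamma$ is amenable if there is a left-invariant finitely additive probability measure defined on all subsets of $\Gamma$. **Theorem 1.2.** Let $(\pi,B)$ be a uniformly bounded representation of $\Gamma$ on a $p$-uniformly smooth Banach space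 $B$. If there is a cocycle $b$ with coefficients in $(\pi,B)$ such that $\|b(g)\|\succ|g|_S^{1/p}$, then $\Gamma$ is amenable. In particular, if $\Gamma$ is not amenable, then no cocycle $b$ with coefficients in a uniformly bounded representation of $\Gamma$ on a Hilbert space satisfies $\|b(g)\|\succ|g|_S^{1/2}$. -/

import Mathlib

open scoped Pointwise

noncomputable section

/-- The word length `|g|_S`: the least `n` such that `g` is a product of `n` elements of `S ∪ S⁻¹`
(so of `S`, when `S` is symmetric). When `S` generates the group, such an `n` exists for every `g`,
see `exists_mem_pow_of_closure_eq_top`. -/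
def wordLength {Γ : Type*} [Group Γ] (S : Set Γ) (g : Γ) : ℕ :=
  sInf {n : ℕ | g ∈ (S ∪ S⁻¹) ^ n}

theorem exists_mem_pow_of_closure_eq_top {Γ : Type*} [Group Γ] {S : Set Γ}
    (hS : Subgroup.closure S = ⊤) (g : Γ) : {n : ℕ | g ∈ (S ∪ S⁻¹) ^ n}.Nonempty := by
  have hg : g ∈ Submonoid.closure (S ∪ S⁻¹) := by
    rw [← Subgroup.closure_toSubmonoid, hS]
    trivial
  induction hg using Submonoid.closure_induction with
  | mem x hx => exact ⟨1, by simpa using hx⟩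
  | one => exact ⟨0, by simp⟩
  | mul x y _ _ hx hy =>
    obtain ⟨m, hm⟩ := hx
    obtain ⟨n, hn⟩ := hy
    refine ⟨m + n, ?_⟩
    show x * y ∈ (S ∪ S⁻¹) ^ (m + n)
    rw [pow_add]
    exact Set.mul_mem_mul hm hn

/-- `f ≺ h` on a discrete group (where compact means finite): for every `ε > 0` we have
`f ≤ ε h` outside a finite set. -/
def StrictlyDominated {Γ : Type*} (f h : Γ → ℝ) : Prop :=
  ∀ ε : ℝ, 0 < ε → ∃ K : Set Γ, K.Finite ∧ ∀ g, g ∉ K → f g ≤ ε * h g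

/-- A discrete group is amenable if it carries a left-invariant finitely additive probability
measure defined on all subsets. -/
def IsAmenableGroup (Γ : Type*) [Group Γ] : Prop :=
  ∃ m : Set Γ → ℝ,
    (∀ A, 0 ≤ m A) ∧
    m Set.univ = 1 ∧
    (∀ A B, Disjoint A B → m (A ∪ B) = m A + m B) ∧
    ∀ (g : Γ) (A : Set Γ), m (g • A) = m A

/-- The modulus of uniform smoothness `ρ_B(τ)` of a normed space. (For `τ ≥ 0` the set is nonempty
and bounded above by `τ`.) -/
def modulusOfSmoothness (B : Type*) [NormedAddCommGroup B] (τ : ℝ) : ℝ :=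
  sSup {r : ℝ | ∃ u v : B, ‖u‖ ≤ 1 ∧ ‖v‖ ≤ τ ∧ r = (‖u + v‖ + ‖u - v‖) / 2 - 1}

/-- `B` is `p`-uniformly smooth: `1 < p ≤ 2` and `ρ_B(τ) ≤ K τ ^ p` for all `τ > 0`. For `B ≠ 0`
one has `ρ_B ≥ 0`, so, as `p > 1`, this includes uniform smoothness, `ρ_B(τ) / τ → 0`
as `τ → 0`. -/
def IsPUniformlySmooth (p : ℝ) (B : Type*) [NormedAddCommGroup B] : Prop :=
  1 < p ∧ p ≤ 2 ∧ ∃ K : ℝ, ∀ τ : ℝ, 0 < τ → modulusOfSmoothness B τ ≤ K * τ ^ p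

section Representation

variable {Γ 𝕜 B : Type*} [Group Γ] [RCLike 𝕜] [NormedAddCommGroup B] [NormedSpace 𝕜 B]

/-- A representation `π : Γ → GL(B)` of a discrete group is uniformly bounded if
`sup_g ‖π(g)‖ < ∞` for the operator norm. -/
def IsUniformlyBoundedRep (π : Γ →* (B ≃L[𝕜] B)) : Prop :=
  ∃ C : ℝ, ∀ g : Γ, ‖(π g : B →L[𝕜] B)‖ ≤ C

/-- `b : Γ → B` is a cocycle with coefficients in `(π, B)`. -/
def IsCocycle (π : Γ →* (B ≃L[𝕜] B)) (b : Γ → B) : Prop :=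
  ∀ g h : Γ, b (g * h) = b g + π g (b h)

end Representation

end

open scoped BigOperators

/-! Suppose the group is not amenable, and let Z_n be the random walk whose steps are products of
two uniform letters from S ∪ S⁻¹ ∪ {1}. Two estimates collide. By the spectral gap, Z_n lies in a
given finite set with exponentially small probability, while balls grow at most exponentially, so
E|Z_n| grows linearly along a subsequence (`exists_wordExpect_wordLength_ge`). On the other hand
E‖b(Z_n)‖^p ≤ D n (`exists_wordExpect_cocycle_le`). Domination gives |g| ≤ M + η‖b(g)‖^p with η as
small as desired, which is incompatible with both.

For the moment bound, b(Z_n) is a sum of translated increments that are not centred. Each odd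
increment is rewritten through b(g) = -π(g) b(g⁻¹), which turns it into an even increment of the
reversed inverse word; the mean of b over the letters then cancels within each pair
(`cocycle_wordProd_eq`). Hence b(Z_n) is a difference of two centred sums, one forward and one
backward, with the same law up to a uniformly bounded operator.

Such sums are martingales, but the norm is not invariant under π. It is replaced by an invariant
convex gauge Φ that dominates a multiple of ‖·‖^p and still satisfies a two-point inequality
(`exists_invariant_gauge`); each step then raises E Φ by at most a constant (`expect_gauge_add_le`).
-/

/-! ### Two-point inequalities and uniform smoothness -/

/-- The function t ↦ t^(p/2) is concave and subadditive; apply it to the squares (m ± d)², whose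
mean is m² + d². -/
theorem add_rpow_add_sub_rpow_le {p m d : ℝ} (hp : 1 ≤ p) (hp2 : p ≤ 2) (hd : 0 ≤ d)
    (hdm : d ≤ m) : (m + d) ^ p + (m - d) ^ p ≤ 2 * (m ^ p + d ^ p) := by
  have hm : 0 ≤ m := hd.trans hdm
  have key : ∀ x : ℝ, 0 ≤ x → x ^ p = (x ^ 2) ^ (p / 2) := fun x hx => by
    rw [← Real.rpow_natCast, ← Real.rpow_mul hx]; congr 1; push_cast; ring
  have hconc := (Real.concaveOn_rpow (p := p / 2) (by linarith) (by linarith)).2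
    (Set.mem_Ici.2 (sq_nonneg (m + d))) (Set.mem_Ici.2 (sq_nonneg (m - d)))
    (show (0 : ℝ) ≤ 1 / 2 by norm_num) (show (0 : ℝ) ≤ 1 / 2 by norm_num) (by norm_num)
  simp only [smul_eq_mul] at hconc
  have h2 : (1 / 2 * (m + d) ^ 2 + 1 / 2 * (m - d) ^ 2) = m ^ 2 + d ^ 2 := by ring
  rw [h2] at hconc
  have h3 := Real.rpow_add_le_add_rpow (p := p / 2) (sq_nonneg m) (sq_nonneg d)
    (by linarith) (by linarith)
  rw [key (m + d) (by linarith), key (m - d) (by linarith), key m hm, key d hd]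
  linarith

/-- The power-type two-point inequality in a `p`-uniformly smooth space. -/
theorem IsPUniformlySmooth.exists_two_point {p : ℝ} {B : Type*} [NormedAddCommGroup B]
    [NormedSpace ℝ B] (h : IsPUniformlySmooth p B) :
    ∃ K : ℝ, 0 ≤ K ∧ ∀ u v : B, ‖u + v‖ ^ p + ‖u - v‖ ^ p ≤ 2 * ‖u‖ ^ p + 2 * (K * ‖v‖ ^ p) := by
  obtain ⟨hp1, hp2, K₀, hK₀⟩ := h
  have hp0 : 0 < p := by linarith
  set K := max K₀ 0 with hKdef
  have hK0 : 0 ≤ K := le_max_right _ _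
  have hmod : ∀ u v : B, ‖u‖ ≤ 1 → 0 < ‖v‖ → (‖u + v‖ + ‖u - v‖) / 2 ≤ 1 + K * ‖v‖ ^ p := by
    intro u v hu hv
    have hb : BddAbove {r : ℝ | ∃ x y : B, ‖x‖ ≤ 1 ∧ ‖y‖ ≤ ‖v‖ ∧
        r = (‖x + y‖ + ‖x - y‖) / 2 - 1} := by
      refine ⟨‖v‖, ?_⟩
      rintro r ⟨x, y, hx, hy, rfl⟩
      have := norm_add_le x y
      have := norm_sub_le x y
      linarith
    have h1 := le_csSup hb ⟨u, v, hu, le_rfl, rfl⟩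
    have h2 := hK₀ ‖v‖ hv
    have h3 : K₀ * ‖v‖ ^ p ≤ K * ‖v‖ ^ p := by gcongr; exact le_max_left _ _
    unfold modulusOfSmoothness at h2
    linarith
  have hunit : ∀ u v : B, ‖u‖ = 1 →
      ‖u + v‖ ^ p + ‖u - v‖ ^ p ≤ 2 * 1 + 2 * ((4 + (2 + K) * K) * ‖v‖ ^ p) := by
    intro u v hu
    rcases eq_or_ne v 0 with rfl | hv0
    · simp [hu, Real.zero_rpow hp0.ne']; norm_num
    have hv : 0 < ‖v‖ := norm_pos_iff.2 hv0
    have hvp : 0 ≤ ‖v‖ ^ p := by positivity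
    have hadd := norm_add_le u v
    have hsub := norm_sub_le u v
    -- For large v the triangle inequality suffices and produces the constant 4. For small v, write
    -- the two norms as m ± d: smoothness bounds m, the triangle inequality bounds d.
    rcases le_total 1 ‖v‖ with h1 | h1
    · have hb : (2 * ‖v‖) ^ p ≤ 4 * ‖v‖ ^ p := by
        rw [Real.mul_rpow (by norm_num) hv.le]
        gcongr
        calc (2 : ℝ) ^ p ≤ 2 ^ (2 : ℝ) := Real.rpow_le_rpow_of_exponent_le (by norm_num) hp2
          _ = 4 := by norm_num
      have ha1 : ‖u + v‖ ^ p ≤ (2 * ‖v‖) ^ p := by gcongr; linarith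
      have ha2 : ‖u - v‖ ^ p ≤ (2 * ‖v‖) ^ p := by gcongr; linarith
      have : 0 ≤ (2 + K) * K * ‖v‖ ^ p := by positivity
      linarith
    · have hvp1 : ‖v‖ ^ p ≤ 1 := Real.rpow_le_one hv.le h1 hp0.le
      set m := (‖u + v‖ + ‖u - v‖) / 2 with hm
      set d := |‖u + v‖ - ‖u - v‖| / 2 with hd
      have hm1 : m ≤ 1 + K * ‖v‖ ^ p := hmod u v hu.le hv
      have hd0 : 0 ≤ d := by positivity
      have hdv : d ≤ ‖v‖ := by
        have h2 : ‖u + v‖ - ‖u - v‖ ≤ 2 * ‖v‖ := by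
          have := norm_sub_norm_le (u + v) (u - v)
          rw [show u + v - (u - v) = (2 : ℝ) • v by module, norm_smul] at this
          simpa using this
        have h3 : ‖u - v‖ - ‖u + v‖ ≤ 2 * ‖v‖ := by
          have := norm_sub_norm_le (u - v) (u + v)
          rw [show u - v - (u + v) = (-2 : ℝ) • v by module, norm_smul] at this
          simpa using this
        rw [hd]
        have := abs_le.2 ⟨by linarith, h2⟩
        linarith
      have hdm : d ≤ m := by
        have := abs_le.2 (⟨by linarith [norm_nonneg (u + v)], by linarith [norm_nonneg (u - v)]⟩ :
          -(‖u + v‖ + ‖u - v‖) ≤ ‖u + v‖ - ‖u - v‖ ∧ _ ≤ ‖u + v‖ + ‖u - v‖)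
        linarith
      have hsum : ‖u + v‖ ^ p + ‖u - v‖ ^ p = (m + d) ^ p + (m - d) ^ p := by
        rcases abs_cases (‖u + v‖ - ‖u - v‖) with ⟨h, _⟩ | ⟨h, _⟩
        · rw [hd, hm, h]; congr 2 <;> ring
        · rw [hd, hm, h, add_comm]; congr 2 <;> ring
      rw [hsum]
      have h4 := add_rpow_add_sub_rpow_le hp1.le hp2 hd0 hdm
      have h5 : d ^ p ≤ ‖v‖ ^ p := by gcongr
      have h6 : m ^ p ≤ 1 + (2 + K) * K * ‖v‖ ^ p := by
        have hx : 0 ≤ K * ‖v‖ ^ p := by positivity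
        have hm0 : 0 ≤ m := hd0.trans hdm
        calc m ^ p ≤ (1 + K * ‖v‖ ^ p) ^ p := by gcongr
          _ ≤ (1 + K * ‖v‖ ^ p) ^ (2 : ℝ) :=
            Real.rpow_le_rpow_of_exponent_le (by linarith) hp2
          _ = (1 + K * ‖v‖ ^ p) ^ 2 := by norm_num
          _ ≤ _ := by nlinarith [mul_nonneg (mul_nonneg hK0 hx) (sub_nonneg.2 hvp1)]
      linarith
  refine ⟨4 + (2 + K) * K, by positivity, fun u v => ?_⟩
  have hvp : 0 ≤ ‖v‖ ^ p := by positivity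
  rcases eq_or_ne u 0 with rfl | hu
  · simp only [zero_add, zero_sub, norm_neg, norm_zero, Real.zero_rpow hp0.ne']
    have : 0 ≤ (2 + K) * K * ‖v‖ ^ p := by positivity
    linarith
  · have hu' : 0 < ‖u‖ := norm_pos_iff.2 hu
    have hn : ∀ w : B, ‖w‖ ^ p = ‖u‖ ^ p * ‖‖u‖⁻¹ • w‖ ^ p := fun w => by
      rw [norm_smul, norm_inv, norm_norm, Real.mul_rpow (by positivity) (by positivity),
        Real.inv_rpow hu'.le]
      field_simp
    have h1 := hunit (‖u‖⁻¹ • u) (‖u‖⁻¹ • v) (by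
      rw [norm_smul, norm_inv, norm_norm]; field_simp)
    rw [← smul_add, ← smul_sub] at h1
    rw [hn (u + v), hn (u - v), hn v]
    have h2 := mul_le_mul_of_nonneg_left h1 (show 0 ≤ ‖u‖ ^ p by positivity)
    linarith

/-- By the parallelogram law the squared mean of the two norms is at most 1 + τ², hence at most (1 +
τ²)². -/
theorem isPUniformlySmooth_two (𝕜 : Type*) {H : Type*} [RCLike 𝕜] [NormedAddCommGroup H]
    [InnerProductSpace 𝕜 H] : IsPUniformlySmooth 2 H := by
  refine ⟨by norm_num, le_rfl, 1, fun τ hτ => csSup_le ⟨_, 0, 0, by simp, by simpa using hτ.le, rfl⟩ ?_⟩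
  rintro r ⟨u, v, hu, hv, rfl⟩
  have h := parallelogram_law_with_norm 𝕜 u v
  have hu2 : ‖u‖ * ‖u‖ ≤ 1 := by nlinarith [norm_nonneg u]
  have hv2 : ‖v‖ * ‖v‖ ≤ τ ^ 2 := by nlinarith [norm_nonneg v]
  have : (‖u + v‖ + ‖u - v‖) / 2 ≤ 1 + τ ^ 2 := by
    apply le_of_sq_le_sq _ (by positivity)
    nlinarith [sq_nonneg (‖u + v‖ - ‖u - v‖), sq_nonneg τ, sq_nonneg (τ ^ 2)]
  rw [show (2 : ℝ) = ((2 : ℕ) : ℝ) by norm_num, Real.rpow_natCast]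
  push_cast
  linarith

/-! ### Convex minorants and the invariant gauge -/

section ConvexMinorant

variable {E : Type*} [AddCommGroup E] [Module ℝ E]

/-- The greatest convex function below `φ`. -/
noncomputable def convexMinorant (φ : E → ℝ) (u : E) : ℝ :=
  sSup {r : ℝ | ∃ f : E → ℝ, ConvexOn ℝ Set.univ f ∧ (∀ v, f v ≤ φ v) ∧ r = f u}

theorem le_convexMinorant {φ f : E → ℝ} (hf : ConvexOn ℝ Set.univ f) (hfφ : ∀ v, f v ≤ φ v)
    (u : E) : f u ≤ convexMinorant φ u := by
  refine le_csSup ⟨φ u, ?_⟩ ⟨f, hf, hfφ, rfl⟩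
  rintro r ⟨g, -, hg, rfl⟩
  exact hg u

theorem convexMinorant_le_of_forall {φ : E → ℝ} (h0 : ∀ v, 0 ≤ φ v) {u : E} {c : ℝ}
    (h : ∀ f : E → ℝ, ConvexOn ℝ Set.univ f → (∀ v, f v ≤ φ v) → f u ≤ c) :
    convexMinorant φ u ≤ c := by
  refine csSup_le ⟨0, fun _ => 0, convexOn_const 0 convex_univ, h0, rfl⟩ ?_
  rintro r ⟨f, hf, hfφ, rfl⟩
  exact h f hf hfφ

theorem convexMinorant_le {φ : E → ℝ} (h0 : ∀ v, 0 ≤ φ v) (u : E) : convexMinorant φ u ≤ φ u :=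
  convexMinorant_le_of_forall h0 fun _ _ h => h u

theorem convexOn_convexMinorant {φ : E → ℝ} (h0 : ∀ v, 0 ≤ φ v) :
    ConvexOn ℝ Set.univ (convexMinorant φ) := by
  refine ⟨convex_univ, fun x _ y _ a b ha hb hab => convexMinorant_le_of_forall h0 ?_⟩
  intro f hf hfφ
  refine (hf.2 trivial trivial ha hb hab).trans ?_
  have := le_convexMinorant hf hfφ
  simp only [smul_eq_mul]
  gcongr <;> apply this

theorem convexMinorant_map {φ : E → ℝ} (h0 : ∀ v, 0 ≤ φ v) (L : E →ₗ[ℝ] E)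
    (hL : ∀ v, φ (L v) ≤ φ v) (u : E) : convexMinorant φ (L u) ≤ convexMinorant φ u := by
  refine convexMinorant_le_of_forall h0 fun f hf hfφ => ?_
  exact le_convexMinorant (f := f ∘ L) (by simpa using hf.comp_linearMap L)
    (fun v => (hfφ _).trans (hL v)) u

/-- The mean of the translates of the minorant by ±v, lowered by c, is convex and lies below φ;
maximality puts it below the minorant. -/
theorem convexMinorant_add_sub {φ : E → ℝ} (h0 : ∀ v, 0 ≤ φ v) {v : E} {c : ℝ}
    (hφ : ∀ u, φ (u + v) + φ (u - v) ≤ 2 * φ u + 2 * c) (u : E) :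
    convexMinorant φ (u + v) + convexMinorant φ (u - v) ≤ 2 * convexMinorant φ u + 2 * c := by
  have hc := convexOn_convexMinorant h0
  have h1 : ConvexOn ℝ Set.univ fun w => convexMinorant φ (w + v) := by
    simpa [Function.comp_def] using hc.translate_left v
  have h2 : ConvexOn ℝ Set.univ fun w => convexMinorant φ (w - v) := by
    simpa [Function.comp_def, sub_eq_add_neg] using hc.translate_left (-v)
  have h3 : ConvexOn ℝ Set.univ fun w =>
      (1 / 2 : ℝ) * (convexMinorant φ (w + v) + convexMinorant φ (w - v)) + -c := by
    exact ((h1.add h2).smul (c := (1 / 2 : ℝ)) (by norm_num)).add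
      (convexOn_const (-c) convex_univ)
  have := le_convexMinorant h3 (φ := φ) (fun w => by
    linarith [hφ w, convexMinorant_le h0 (w + v), convexMinorant_le h0 (w - v)]) u
  linarith

end ConvexMinorant

/-- For a uniformly bounded representation on a space with a two-point inequality there is an
invariant convex gauge, comparable with `‖·‖ ^ p` from below, with the same kind of inequality. -/
theorem exists_invariant_gauge {Γ E : Type*} [Group Γ] [NormedAddCommGroup E] [NormedSpace ℝ E]
    (π : Γ →* Module.End ℝ E) {C p K : ℝ} (hp : 1 ≤ p) (hC : 0 < C) (hK : 0 ≤ K)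
    (hπ : ∀ g v, ‖π g v‖ ≤ C * ‖v‖)
    (hE : ∀ u v : E, ‖u + v‖ ^ p + ‖u - v‖ ^ p ≤ 2 * ‖u‖ ^ p + 2 * (K * ‖v‖ ^ p)) :
    ∃ Φ : E → ℝ, ConvexOn ℝ Set.univ Φ ∧ (∀ g v, Φ (π g v) = Φ v) ∧ Φ 0 ≤ 0 ∧
      (∀ v, ‖v‖ ^ p ≤ C ^ p * Φ v) ∧
      ∀ u v, Φ (u + v) + Φ (u - v) ≤ 2 * Φ u + 2 * (K * C ^ p * ‖v‖ ^ p) := by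
  have hp0 : 0 < p := by linarith
  -- An infimum over the orbit keeps the two-point inequality, since one g can serve all three
  -- terms; a supremum would be convex but could need different g on the left. Convexity is restored
  -- by the minorant.
  set φ : E → ℝ := fun v => ⨅ g : Γ, ‖π g v‖ ^ p with hφ
  have hbdd : ∀ v, BddBelow (Set.range fun g : Γ => ‖π g v‖ ^ p) := fun v =>
    ⟨0, by rintro _ ⟨g, rfl⟩; positivity⟩
  have hle : ∀ g v, φ v ≤ ‖π g v‖ ^ p := fun g v => ciInf_le (hbdd v) g
  have h0 : ∀ v, 0 ≤ φ v := fun v => le_ciInf fun g => by positivity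
  have hmap : ∀ g v, φ (π g v) ≤ φ v := fun g v => le_ciInf fun k => by
    have := hle (k * g⁻¹) (π g v)
    rwa [← Module.End.mul_apply, ← map_mul, inv_mul_cancel_right] at this
  have hmap' := fun g => convexMinorant_map h0 (π g) (hmap g)
  have hlow : ∀ v, (C ^ p)⁻¹ * ‖v‖ ^ p ≤ φ v := fun v => le_ciInf fun g => by
    have h1 : ‖v‖ ≤ C * ‖π g v‖ := by
      have := hπ g⁻¹ (π g v)
      rwa [← Module.End.mul_apply, ← map_mul, inv_mul_cancel, map_one] at this
    rw [inv_mul_le_iff₀ (by positivity), ← Real.mul_rpow hC.le (norm_nonneg _)]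
    gcongr
  have hconv : ConvexOn ℝ Set.univ fun v : E => (C ^ p)⁻¹ * ‖v‖ ^ p := by
    have h1 : ConvexOn ℝ Set.univ fun v : E => ‖v‖ ^ p := by
      refine ⟨convex_univ, fun x _ y _ a b ha hb hab => ?_⟩
      refine le_trans ?_ ((convexOn_rpow hp).2 (norm_nonneg x) (norm_nonneg y) ha hb hab)
      have h2 : ‖a • x + b • y‖ ≤ a • ‖x‖ + b • ‖y‖ := convexOn_univ_norm.2 trivial trivial ha hb hab
      exact Real.rpow_le_rpow (norm_nonneg _) h2 hp0.le
    exact h1.smul (by positivity)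
  refine ⟨convexMinorant φ, convexOn_convexMinorant h0, fun g v => le_antisymm (hmap' g v) ?_, ?_,
    fun v => ?_, fun u v => ?_⟩
  · have := hmap' g⁻¹ (π g v)
    rwa [← Module.End.mul_apply, ← map_mul, inv_mul_cancel, map_one] at this
  · refine (convexMinorant_le h0 0).trans ((hle 1 0).trans_eq ?_)
    simp [Real.zero_rpow hp0.ne']
  · rw [← inv_mul_le_iff₀ (by positivity)]
    exact le_convexMinorant hconv hlow v
  · refine convexMinorant_add_sub h0 (fun u => ?_) u
    suffices (φ (u + v) + φ (u - v)) / 2 - K * C ^ p * ‖v‖ ^ p ≤ φ u by linarith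
    refine le_ciInf fun g => ?_
    have h1 := hE (π g u) (π g v)
    rw [← map_add, ← map_sub] at h1
    have h2 : K * ‖π g v‖ ^ p ≤ K * C ^ p * ‖v‖ ^ p := by
      rw [mul_assoc, ← Real.mul_rpow hC.le (norm_nonneg _)]
      have := hπ g v
      gcongr
    linarith [hle g (u + v), hle g (u - v)]

/-! ### Averages over words -/

section WordExpect

variable {ι : Type*} [Fintype ι]

/-- The average of `f` over all words of length `n` in the letters `ι`. -/
noncomputable def wordExpect : ℕ → (List ι → ℝ) → ℝ
  | 0, f => f []
  | n + 1, f => 𝔼 i, wordExpect n fun l => f (i :: l)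

theorem wordExpect_mono (n : ℕ) {f g : List ι → ℝ} (h : ∀ l, f l ≤ g l) :
    wordExpect n f ≤ wordExpect n g := by
  induction n generalizing f g with
  | zero => exact h []
  | succ n ih => exact Finset.expect_le_expect fun i _ => ih fun l => h _

theorem wordExpect_add (n : ℕ) (f g : List ι → ℝ) :
    wordExpect n (fun l => f l + g l) = wordExpect n f + wordExpect n g := by
  induction n generalizing f g with
  | zero => rfl
  | succ n ih => simp only [wordExpect, ih, Finset.expect_add_distrib]

theorem wordExpect_mul (n : ℕ) (c : ℝ) (f : List ι → ℝ) :
    wordExpect n (fun l => c * f l) = c * wordExpect n f := by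
  induction n generalizing f with
  | zero => rfl
  | succ n ih => simp only [wordExpect, ih, Finset.mul_expect]

theorem wordExpect_const [Nonempty ι] (n : ℕ) (c : ℝ) :
    wordExpect n (fun _ : List ι => c) = c := by
  induction n with
  | zero => rfl
  | succ n ih => simp only [wordExpect, ih, Fintype.expect_const]

theorem wordExpect_succ_append (n : ℕ) (f : List ι → ℝ) :
    wordExpect (n + 1) f = 𝔼 i, wordExpect n fun l => f (l ++ [i]) := by
  induction n generalizing f with
  | zero => rfl
  | succ n ih =>
    rw [wordExpect, Finset.expect_congr rfl fun i _ => ih fun l => f (i :: l), Finset.expect_comm]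
    rfl

/-- Averages over words are invariant under reversal combined with a permutation of the letters. -/
theorem wordExpect_reverse (σ : ι ≃ ι) (n : ℕ) (f : List ι → ℝ) :
    wordExpect n (fun l => f (l.map σ).reverse) = wordExpect n f := by
  induction n generalizing f with
  | zero => rfl
  | succ n ih =>
    rw [wordExpect_succ_append n f, wordExpect]
    refine Fintype.expect_equiv σ _ _ fun i => ?_
    rw [← ih fun l => f (l ++ [σ i])]
    simp

end WordExpect

/-! ### Martingale bound for cocycles along the walk -/

section Martingale

variable {Γ E τ : Type*} [Group Γ] [NormedAddCommGroup E] [NormedSpace ℝ E]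

/-- The value at the end of a word in pairs of letters. -/
def wordProd (a : τ → Γ) (l : List (τ × τ)) : Γ := (l.map fun q => a q.1 * a q.2).prod

/-- The sum of the increments at even times along a word of even length. -/
def evenSum (π : Γ →* Module.End ℝ E) (a : τ → Γ) (X : τ → E) : List (τ × τ) → E
  | [] => 0
  | q :: l => π (a q.1) (X q.2) + π (a q.1 * a q.2) (evenSum π a X l)

theorem wordProd_cons (a : τ → Γ) (q : τ × τ) (l : List (τ × τ)) :
    wordProd a (q :: l) = a q.1 * a q.2 * wordProd a l := by simp [wordProd]

theorem wordProd_append_singleton (a : τ → Γ) (q : τ × τ) (l : List (τ × τ)) :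
    wordProd a (l ++ [q]) = wordProd a l * (a q.1 * a q.2) := by simp [wordProd]

theorem evenSum_append_singleton (π : Γ →* Module.End ℝ E) (a : τ → Γ) (X : τ → E) (q : τ × τ)
    (l : List (τ × τ)) :
    evenSum π a X (l ++ [q]) = evenSum π a X l + π (wordProd a l * a q.1) (X q.2) := by
  induction l with
  | nil => simp [evenSum, wordProd]
  | cons r l ih =>
    simp only [List.cons_append, evenSum, ih, wordProd_cons, map_add, add_assoc, mul_assoc,
      map_mul, Module.End.mul_apply]

/-- Reversal of a word, as a permutation of pairs of letters. -/
def swapInv (inv : τ ≃ τ) : τ × τ ≃ τ × τ := (Equiv.prodComm τ τ).trans (inv.prodCongr inv)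

theorem wordProd_reverse {inv : τ ≃ τ} {a : τ → Γ} (hinv : ∀ t, a (inv t) = (a t)⁻¹)
    (l : List (τ × τ)) :
    wordProd a (l.map (swapInv inv)).reverse = (wordProd a l)⁻¹ := by
  induction l with
  | nil => simp [wordProd]
  | cons q l ih =>
    rw [List.map_cons, List.reverse_cons, wordProd_append_singleton, ih, wordProd_cons]
    simp [swapInv, hinv]

/-- A cocycle along a word of even length is the difference of two martingale sums. -/
theorem cocycle_wordProd_eq (π : Γ →* Module.End ℝ E) {b : Γ → E}
    (hb : ∀ g h, b (g * h) = b g + π g (b h)) {inv : τ ≃ τ} {a : τ → Γ}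
    (hinv : ∀ t, a (inv t) = (a t)⁻¹) (z : E) (l : List (τ × τ)) :
    b (wordProd a l) = evenSum π a (fun t => b (a t) - z) l -
      π (wordProd a l) (evenSum π a (fun t => b (a t) - z) (l.map (swapInv inv)).reverse) := by
  have hb1 : b 1 = 0 := by simpa using hb 1 1
  have hbinv : ∀ g, b g = -π g (b g⁻¹) := fun g => by
    have := hb g g⁻¹
    rw [mul_inv_cancel, hb1] at this
    exact eq_neg_of_add_eq_zero_left this.symm
  have hcancel : ∀ (g h : Γ) (v : E), π g (π h v) = π (g * h) v := fun g h v => by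
    rw [map_mul, Module.End.mul_apply]
  induction l with
  | nil => simp [wordProd, evenSum, hb1]
  | cons q l ih =>
    rw [List.map_cons, List.reverse_cons, evenSum_append_singleton, wordProd_reverse hinv,
      wordProd_cons, evenSum, hb, ih, hb, hbinv (a q.1)]
    have h1 : a (swapInv inv q).1 = (a q.2)⁻¹ := hinv _
    have h2 : a (swapInv inv q).2 = (a q.1)⁻¹ := hinv _
    simp only [h1, h2, map_add, map_sub, hcancel]
    simp only [show a q.1 * a q.2 * wordProd a l * ((wordProd a l)⁻¹ * (a q.2)⁻¹) = a q.1 by group]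
    abel

/-- One step of a martingale, in terms of a gauge with the two-point inequality. -/
theorem expect_gauge_add_le [Fintype τ] [Nonempty τ] {Φ : E → ℝ} (hconv : ConvexOn ℝ Set.univ Φ)
    {p K : ℝ} (h2 : ∀ u v, Φ (u + v) + Φ (u - v) ≤ 2 * Φ u + 2 * (K * ‖v‖ ^ p)) {X : τ → E}
    (hX : ∑ t, X t = 0) (u : E) :
    𝔼 t, Φ (u + X t) ≤ Φ u + 𝔼 t, 2 * (K * ‖X t‖ ^ p) := by
  have hcard : (Fintype.card τ : ℝ) ≠ 0 := by simp
  -- Jensen for -X: it absorbs one of the two copies of Φ u in the two-point inequality, so no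
  -- symmetry of X is needed.
  have hJ : Φ u ≤ 𝔼 t, Φ (u - X t) := by
    have := hconv.map_sum_le (t := Finset.univ) (w := fun _ : τ => (Fintype.card τ : ℝ)⁻¹)
      (p := fun t => u - X t) (fun _ _ => by positivity) (by simp) (fun _ _ => trivial)
    rw [← Finset.smul_sum, Finset.sum_sub_distrib, hX, sub_zero, Finset.sum_const,
      Finset.card_univ, ← Nat.cast_smul_eq_nsmul ℝ, smul_smul, inv_mul_cancel₀ hcard,
      one_smul] at this
    rw [Fintype.expect_eq_sum_div_card, div_eq_inv_mul, Finset.mul_sum]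
    exact this
  have hsum : 𝔼 t, (Φ (u + X t) + Φ (u - X t)) ≤ 𝔼 t, (2 * Φ u + 2 * (K * ‖X t‖ ^ p)) :=
    Finset.expect_le_expect fun t _ => h2 u (X t)
  rw [Finset.expect_add_distrib, Finset.expect_add_distrib, Fintype.expect_const] at hsum
  linarith

theorem wordExpect_gauge_evenSum_le [Fintype τ] [Nonempty τ] (π : Γ →* Module.End ℝ E) {Φ : E → ℝ}
    (hconv : ConvexOn ℝ Set.univ Φ) (hinvt : ∀ g v, Φ (π g v) = Φ v) {p K : ℝ}
    (h2 : ∀ u v, Φ (u + v) + Φ (u - v) ≤ 2 * Φ u + 2 * (K * ‖v‖ ^ p)) (a : τ → Γ) {X : τ → E}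
    (hX : ∑ t, X t = 0) (n : ℕ) (v : E) :
    wordExpect n (fun l => Φ (v + evenSum π a X l)) ≤ Φ v + n * 𝔼 t, 2 * (K * ‖X t‖ ^ p) := by
  set c := 𝔼 t, 2 * (K * ‖X t‖ ^ p)
  induction n generalizing v with
  | zero => simp [wordExpect, evenSum]
  | succ n ih =>
    have hstep : ∀ q : τ × τ, wordExpect n (fun l => Φ (v + evenSum π a X (q :: l))) ≤
        Φ (π (a q.1)⁻¹ v + X q.2) + n * c := fun q => by
      -- Invariance removes the operator of the first pair, so the rest of the word restarts from a
      -- new base point; this is why v is arbitrary in the induction.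
      have h3 : ∀ l, Φ (v + evenSum π a X (q :: l)) =
          Φ (π (a q.2)⁻¹ (π (a q.1)⁻¹ v + X q.2) + evenSum π a X l) := fun l => by
        rw [← hinvt (a q.1 * a q.2) (_ + evenSum π a X l)]
        simp only [evenSum, map_add, ← Module.End.mul_apply, ← map_mul]
        simp [add_assoc]
      simp only [h3]
      refine (ih _).trans_eq ?_
      rw [hinvt]
    rw [wordExpect]
    refine (Finset.expect_le_expect fun q _ => hstep q).trans ?_
    rw [Finset.expect_add_distrib, Fintype.expect_const, ← Finset.univ_product_univ,
      Finset.expect_product]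
    have h4 : 𝔼 s : τ, 𝔼 t : τ, Φ (π (a s)⁻¹ v + X t) ≤ 𝔼 _s : τ, (Φ v + c) :=
      Finset.expect_le_expect fun s _ => by
        have := expect_gauge_add_le hconv h2 hX (π (a s)⁻¹ v)
        rwa [hinvt] at this
    rw [Fintype.expect_const] at h4
    push_cast
    linarith

theorem add_rpow_le_two_rpow_mul {x y p : ℝ} (hx : 0 ≤ x) (hy : 0 ≤ y) (hp : 1 ≤ p) :
    (x + y) ^ p ≤ 2 ^ (p - 1) * (x ^ p + y ^ p) := by
  lift x to NNReal using hx
  lift y to NNReal using hy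
  exact_mod_cast NNReal.rpow_add_le_mul_rpow_add_rpow x y hp

/-- In a space with the two-point inequality, a cocycle for a uniformly bounded representation has
`p`-th moment growing at most linearly along the simple random walk. -/
theorem exists_wordExpect_cocycle_le [Fintype τ] [Nonempty τ] (π : Γ →* Module.End ℝ E)
    {C p K : ℝ} (hp : 1 ≤ p) (hK : 0 ≤ K) (hπ : ∀ g v, ‖π g v‖ ≤ C * ‖v‖)
    (hE : ∀ u v : E, ‖u + v‖ ^ p + ‖u - v‖ ^ p ≤ 2 * ‖u‖ ^ p + 2 * (K * ‖v‖ ^ p))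
    {b : Γ → E} (hb : ∀ g h, b (g * h) = b g + π g (b h)) {inv : τ ≃ τ} {a : τ → Γ}
    (hinv : ∀ t, a (inv t) = (a t)⁻¹) :
    ∃ D : ℝ, 0 ≤ D ∧ ∀ n : ℕ, wordExpect n (fun l => ‖b (wordProd a l)‖ ^ p) ≤ D * n := by
  have hp0 : 0 < p := by linarith
  wlog hC : 0 < C generalizing C
  · exact this (C := 1) (fun g v => (hπ g v).trans (by
      nlinarith [norm_nonneg v, not_lt.1 hC])) one_pos
  obtain ⟨Φ, hconv, hinvt, hΦ0, hlow, h2⟩ := exists_invariant_gauge π hp hC hK hπ hE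
  set z : E := (Fintype.card τ : ℝ)⁻¹ • ∑ t, b (a t) with hz
  set X : τ → E := fun t => b (a t) - z with hXdef
  have hX : ∑ t, X t = 0 := by
    rw [hXdef, Finset.sum_sub_distrib, Finset.sum_const, Finset.card_univ,
      ← Nat.cast_smul_eq_nsmul ℝ, hz, smul_smul, mul_inv_cancel₀ (by simp), one_smul, sub_self]
  set c := 𝔼 t, 2 * (K * C ^ p * ‖X t‖ ^ p) with hc
  have hc0 : 0 ≤ c := Finset.expect_nonneg fun t _ => by positivity
  set A := evenSum π a X with hA
  have hmean : ∀ n : ℕ, wordExpect n (fun l => ‖A l‖ ^ p) ≤ C ^ p * (n * c) := fun n => by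
    refine (wordExpect_mono n fun l => hlow (A l)).trans ?_
    rw [wordExpect_mul]
    have := wordExpect_gauge_evenSum_le π hconv hinvt h2 a hX n 0
    simp only [zero_add] at this
    gcongr
    linarith
  set R : List (τ × τ) → List (τ × τ) := fun l => (l.map (swapInv inv)).reverse with hR
  have hpt : ∀ l, ‖b (wordProd a l)‖ ^ p ≤
      2 ^ (p - 1) * (‖A l‖ ^ p + C ^ p * ‖A (R l)‖ ^ p) := fun l => by
    rw [cocycle_wordProd_eq π hb hinv z l, ← Real.mul_rpow hC.le (norm_nonneg _)]
    have h3 := hπ (wordProd a l) (A (R l))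
    calc ‖A l - π (wordProd a l) (A (R l))‖ ^ p ≤ (‖A l‖ + C * ‖A (R l)‖) ^ p := by
          gcongr
          exact (norm_sub_le _ _).trans (by gcongr)
      _ ≤ _ := add_rpow_le_two_rpow_mul (norm_nonneg _) (by positivity) hp
  refine ⟨2 ^ (p - 1) * (1 + C ^ p) * (C ^ p * c), by positivity, fun n => ?_⟩
  refine (wordExpect_mono n hpt).trans ?_
  rw [wordExpect_mul, wordExpect_add, wordExpect_mul,
    wordExpect_reverse (swapInv inv) n (fun l => ‖A l‖ ^ p)]
  have h5 := hmean n
  calc _ ≤ 2 ^ (p - 1) * (C ^ p * (n * c) + C ^ p * (C ^ p * (n * c))) := by gcongr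
    _ = _ := by ring

end Martingale

/-! ### Non-amenability, spectral gap and return probabilities -/

section SpectralGap

theorem summable_sq_sub {α : Type*} {f h : α → ℝ} (hf : Summable fun g => f g ^ 2)
    (hh : Summable fun g => h g ^ 2) : Summable fun g => (f g - h g) ^ 2 :=
  Summable.of_nonneg_of_le (fun _ => sq_nonneg _)
    (fun g => by nlinarith [sq_nonneg (f g + h g)]) ((hf.add hh).mul_left 2)

/-- The variance is (2N²)⁻¹ times the sum of (x i - x j)² over all ordered pairs, N being the number
of indices; only the pairs containing i₀ are kept. Later i₀ is the identity letter. -/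
theorem sq_expect_le {ι : Type*} [Fintype ι] (x : ι → ℝ) (i₀ : ι) :
    (𝔼 i, x i) ^ 2 ≤ 𝔼 i, x i ^ 2 - ((Fintype.card ι : ℝ) ^ 2)⁻¹ * ∑ i, (x i - x i₀) ^ 2 := by
  classical
  have : Nonempty ι := ⟨i₀⟩
  set N : ℝ := (Fintype.card ι : ℝ) with hN
  have hN0 : 0 < N := by simp [hN, Fintype.card_pos]
  have hdouble : ∑ i, ∑ j, (x i - x j) ^ 2 = 2 * (N * ∑ i, x i ^ 2 - (∑ i, x i) ^ 2) := by
    simp only [sub_sq, Finset.sum_add_distrib, Finset.sum_sub_distrib, Finset.sum_const,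
      Finset.card_univ, nsmul_eq_mul, ← Finset.mul_sum, ← Finset.sum_mul]
    rw [← hN]
    ring
  have hlow : 2 * ∑ i, (x i - x i₀) ^ 2 ≤ ∑ i, ∑ j, (x i - x j) ^ 2 := by
    rw [← Finset.add_sum_erase _ (fun i => ∑ j, (x i - x j) ^ 2) (Finset.mem_univ i₀), two_mul]
    refine add_le_add (Finset.sum_le_sum fun i _ => (sub_sq_comm (x i) (x i₀)).le) ?_
    rw [← Finset.sum_erase (a := i₀) _ (by simp)]
    exact Finset.sum_le_sum fun i _ => Finset.single_le_sum
      (f := fun j => (x i - x j) ^ 2) (fun j _ => sq_nonneg _) (Finset.mem_univ i₀)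
  rw [Fintype.expect_eq_sum_div_card, Fintype.expect_eq_sum_div_card, ← hN, div_pow,
    inv_mul_eq_div]
  have h3 : (∑ i, x i ^ 2) / N = N * (∑ i, x i ^ 2) / N ^ 2 := by field_simp
  rw [h3, ← sub_div]
  gcongr
  linarith

variable {Γ ι : Type*} [Group Γ]

theorem summable_sq_mul_right {f : Γ → ℝ} (hf : Summable fun g => f g ^ 2) (s : Γ) :
    Summable fun g => f (g * s) ^ 2 :=
  (Equiv.mulRight s).summable_iff (f := fun g => f g ^ 2) |>.2 hf

theorem tsum_sq_mul_right (f : Γ → ℝ) (s : Γ) : ∑' g, f (g * s) ^ 2 = ∑' g, f g ^ 2 :=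
  (Equiv.mulRight s).tsum_eq fun g => f g ^ 2

/-- The mass which `f ^ 2` gives to the inverse of a set. -/
noncomputable def sqMass (f : Γ → ℝ) (A : Set Γ) : ℝ :=
  ∑' g, Set.indicator {g : Γ | g⁻¹ ∈ A} (fun g => f g ^ 2) g

theorem sqMass_nonneg (f : Γ → ℝ) (A : Set Γ) : 0 ≤ sqMass f A :=
  tsum_nonneg fun g => Set.indicator_nonneg (fun _ _ => sq_nonneg _) g

theorem sqMass_univ (f : Γ → ℝ) : sqMass f Set.univ = ∑' g, f g ^ 2 := by
  simp [sqMass]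

theorem sqMass_union {f : Γ → ℝ} (hf : Summable fun g => f g ^ 2) {A B : Set Γ}
    (hAB : Disjoint A B) : sqMass f (A ∪ B) = sqMass f A + sqMass f B := by
  rw [sqMass, sqMass, sqMass, ← (hf.indicator _).tsum_add (hf.indicator _)]
  congr 1 with g
  have hd : Disjoint {g : Γ | g⁻¹ ∈ A} {g : Γ | g⁻¹ ∈ B} :=
    Set.disjoint_left.2 fun g hA hB => Set.disjoint_left.1 hAB hA hB
  exact congrFun (Set.indicator_union_of_disjoint hd fun g => f g ^ 2) g

theorem sqMass_le_one {f : Γ → ℝ} (hf : Summable fun g => f g ^ 2) (h1 : ∑' g, f g ^ 2 = 1)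
    (A : Set Γ) : sqMass f A ≤ 1 := by
  rw [← h1]
  exact (hf.indicator _).tsum_le_tsum
    (Set.indicator_le_self' fun g _ => sq_nonneg (f g)) hf

/-- Factor the difference of squares and use weighted AM-GM with weight δ pointwise; summation gives
δ/2 + 2δ. -/
theorem abs_sqMass_smul_sub_le {f : Γ → ℝ} (hf : Summable fun g => f g ^ 2)
    (h1 : ∑' g, f g ^ 2 = 1) {δ : ℝ} (hδ : 0 < δ) {s : Γ}
    (hs : ∑' g, (f (g * s) - f g) ^ 2 ≤ δ ^ 2) (A : Set Γ) :
    |sqMass f (s • A) - sqMass f A| ≤ 3 * δ := by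
  set I : Set Γ := {g | (g * s)⁻¹ ∈ A}
  have hfs := summable_sq_mul_right hf s
  have hd := summable_sq_sub hfs hf
  have e1 : sqMass f (s • A) = ∑' g, I.indicator (fun g => f g ^ 2) g := by
    rw [sqMass]
    congr 2 with g
    simp [I, Set.mem_smul_set_iff_inv_smul_mem]
  have e2 : sqMass f A = ∑' g, I.indicator (fun g => f (g * s) ^ 2) g :=
    ((Equiv.mulRight s).tsum_eq _).symm
  have hR : Summable fun g => (2 * δ)⁻¹ * (f (g * s) - f g) ^ 2 +
      δ * (f g ^ 2 + f (g * s) ^ 2) := (hd.mul_left _).add ((hf.add hfs).mul_left _)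
  rw [e1, e2, ← (hf.indicator _).tsum_sub (hfs.indicator _), ← Real.norm_eq_abs]
  refine (tsum_of_norm_bounded hR.hasSum fun g => ?_).trans ?_
  · have key : |f g ^ 2 - f (g * s) ^ 2| ≤ (2 * δ)⁻¹ * (f (g * s) - f g) ^ 2 +
        δ * (f g ^ 2 + f (g * s) ^ 2) := by
      have h2 : f g ^ 2 - f (g * s) ^ 2 = (f g - f (g * s)) * (f g + f (g * s)) := by ring
      have h3 : (2 * δ)⁻¹ * (f (g * s) - f g) ^ 2 =
          (2 * δ) * ((2 * δ)⁻¹ * (f g - f (g * s))) ^ 2 := by field_simp; ring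
      set x := (2 * δ)⁻¹ * (f g - f (g * s)) with hx
      have h4 : f g - f (g * s) = 2 * δ * x := by rw [hx]; field_simp
      rw [h2, h3]
      set y := f g + f (g * s) with hy
      have h5 : y ^ 2 ≤ 2 * (f g ^ 2 + f (g * s) ^ 2) := by
        nlinarith [sq_nonneg (f g - f (g * s))]
      rw [h4, abs_le]
      constructor <;> nlinarith [mul_nonneg hδ.le (sq_nonneg (2 * x - y)),
        mul_nonneg hδ.le (sq_nonneg (2 * x + y)), mul_nonneg hδ.le (sub_nonneg.2 h5)]
    by_cases hg : g ∈ I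
    · simpa [hg] using key
    · simpa [hg] using (abs_nonneg _).trans key
  · rw [(hd.mul_left _).tsum_add ((hf.add hfs).mul_left _), tsum_mul_left, tsum_mul_left,
      hf.tsum_add hfs, tsum_sq_mul_right, h1]
    have : (2 * δ)⁻¹ * ∑' g, (f (g * s) - f g) ^ 2 ≤ (2 * δ)⁻¹ * δ ^ 2 := by gcongr
    have h6 : (2 * δ)⁻¹ * δ ^ 2 = δ / 2 := by field_simp
    linarith

/-- A group with almost invariant vectors in `ℓ²` is amenable. -/
theorem isAmenableGroup_of_almost_invariant {w : ι → Γ}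
    (hw : Subgroup.closure (Set.range w) = ⊤)
    (h : ∀ δ : ℝ, 0 < δ → ∃ f : Γ → ℝ, Summable (fun g => f g ^ 2) ∧ ∑' g, f g ^ 2 = 1 ∧
      ∀ i, ∑' g, (f (g * w i) - f g) ^ 2 ≤ δ ^ 2) : IsAmenableGroup Γ := by
  choose f hf h1 hinv using fun n : ℕ => h (1 / ((n : ℝ) + 1)) (by positivity)
  set U := Filter.hyperfilter ℕ
  -- The invariant mean is an ultrafilter limit of the masses in the compact cube of all
  -- [0,1]-valued set functions.
  have hcomp : IsCompact (Set.univ.pi fun _ : Set Γ => Set.Icc (0 : ℝ) 1) :=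
    isCompact_univ_pi fun _ => isCompact_Icc
  obtain ⟨m, -, hm⟩ := hcomp.ultrafilter_le_nhds (U.map fun n => sqMass (f n)) (by
    refine Filter.tendsto_principal.2 (Filter.Eventually.of_forall fun n A _ => ?_)
    exact ⟨sqMass_nonneg _ _, sqMass_le_one (hf n) (h1 n) A⟩)
  have hlim : ∀ A, Filter.Tendsto (fun n => sqMass (f n) A) U (nhds (m A)) := fun A =>
    tendsto_pi_nhds.1 (show Filter.Tendsto (fun n => sqMass (f n)) U (nhds m) from hm) A
  have hdelta : Filter.Tendsto (fun n : ℕ => 3 * (1 / ((n : ℝ) + 1))) U (nhds 0) := by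
    have := (tendsto_one_div_add_atTop_nhds_zero_nat (𝕜 := ℝ)).const_mul 3
    rw [mul_zero] at this
    exact this.mono_left Nat.hyperfilter_le_atTop
  refine ⟨m, fun A => ge_of_tendsto' (hlim A) fun n => sqMass_nonneg _ _, ?_, fun A B hAB => ?_,
    fun g => ?_⟩
  · refine tendsto_nhds_unique (hlim _) ?_
    simp only [sqMass_univ, h1]
    exact tendsto_const_nhds
  · refine tendsto_nhds_unique (hlim _) ?_
    simp only [fun n => sqMass_union (hf n) hAB]
    exact (hlim A).add (hlim B)
  · have hg : g ∈ Subgroup.closure (Set.range w) := hw ▸ Subgroup.mem_top g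
    induction hg using Subgroup.closure_induction with
    | mem x hx =>
      obtain ⟨i, rfl⟩ := hx
      intro A
      have h2 : Filter.Tendsto (fun n => sqMass (f n) (w i • A) - sqMass (f n) A) U (nhds 0) :=
        squeeze_zero_norm
          (fun n => abs_sqMass_smul_sub_le (hf n) (h1 n) (by positivity) (hinv n i) A) hdelta
      exact sub_eq_zero.1 (tendsto_nhds_unique ((hlim _).sub (hlim _)) h2)
    | one => simp
    | mul x y _ _ hx hy => intro A; rw [mul_smul, hx, hy]
    | inv x _ hx => intro A; rw [← hx (x⁻¹ • A), smul_inv_smul]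

/-- A non-amenable group has a spectral gap for each finite family of generators. -/
theorem exists_gap_of_not_isAmenableGroup [Fintype ι] {w : ι → Γ}
    (hw : Subgroup.closure (Set.range w) = ⊤) (hΓ : ¬ IsAmenableGroup Γ) :
    ∃ ε : ℝ, 0 < ε ∧ ∀ f : Γ → ℝ, Summable (fun g => f g ^ 2) →
      ε * ∑' g, f g ^ 2 ≤ ∑ i, ∑' g, (f (g * w i) - f g) ^ 2 := by
  by_contra! hcon
  refine hΓ (isAmenableGroup_of_almost_invariant hw fun δ hδ => ?_)
  obtain ⟨f, hf, hlt⟩ := hcon (δ ^ 2) (by positivity)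
  have hterm : ∀ i, 0 ≤ ∑' g, (f (g * w i) - f g) ^ 2 := fun i => tsum_nonneg fun g => sq_nonneg _
  set N := ∑' g, f g ^ 2 with hN
  have hNpos : 0 < N := by
    have h0 := Finset.sum_nonneg fun i (_ : i ∈ Finset.univ) => hterm i
    by_contra! hN'
    nlinarith [sq_nonneg δ]
  have hsq : ∀ x : ℝ, ((√N)⁻¹ * x) ^ 2 = N⁻¹ * x ^ 2 := fun x => by
    rw [mul_pow, inv_pow, Real.sq_sqrt hNpos.le]
  refine ⟨fun g => (√N)⁻¹ * f g, ?_, ?_, fun i => ?_⟩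
  · simp only [hsq]; exact hf.mul_left _
  · simp only [hsq, tsum_mul_left]; exact inv_mul_cancel₀ hNpos.ne'
  · simp only [← mul_sub, hsq, tsum_mul_left]
    rw [inv_mul_le_iff₀ hNpos, mul_comm N]
    exact (Finset.single_le_sum (fun i _ => hterm i) (Finset.mem_univ i)).trans hlt.le

/-- With a spectral gap, averaging over the generators is a contraction of `ℓ²`. -/
theorem summable_and_tsum_sq_expect_le [Fintype ι] {w : ι → Γ} {i₀ : ι} (hi₀ : w i₀ = 1) {ε : ℝ}
    {f : Γ → ℝ} (hf : Summable fun g => f g ^ 2)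
    (hgap : ε * ∑' g, f g ^ 2 ≤ ∑ i, ∑' g, (f (g * w i) - f g) ^ 2) :
    Summable (fun g => (𝔼 i, f (g * w i)) ^ 2) ∧
      ∑' g, (𝔼 i, f (g * w i)) ^ 2 ≤
        (1 - ((Fintype.card ι : ℝ) ^ 2)⁻¹ * ε) * ∑' g, f g ^ 2 := by
  have : Nonempty ι := ⟨i₀⟩
  set κ : ℝ := ((Fintype.card ι : ℝ) ^ 2)⁻¹ with hκ
  have hpt : ∀ g, (𝔼 i, f (g * w i)) ^ 2 ≤
      (Fintype.card ι : ℝ)⁻¹ * ∑ i, f (g * w i) ^ 2 - κ * ∑ i, (f (g * w i) - f g) ^ 2 := fun g => by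
    have := sq_expect_le (fun i => f (g * w i)) i₀
    simp only [hi₀, mul_one] at this
    rwa [Fintype.expect_eq_sum_div_card (fun i => f (g * w i) ^ 2), div_eq_inv_mul] at this
  have s1 : ∀ i ∈ Finset.univ, Summable fun g => f (g * w i) ^ 2 :=
    fun i _ => summable_sq_mul_right hf _
  have s2 : ∀ i ∈ Finset.univ, Summable fun g => (f (g * w i) - f g) ^ 2 :=
    fun i hi => summable_sq_sub (s1 i hi) hf
  have s3 := ((summable_sum s1).mul_left (Fintype.card ι : ℝ)⁻¹).sub
    ((summable_sum s2).mul_left κ)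
  have s4 := Summable.of_nonneg_of_le (fun _ => sq_nonneg _) hpt s3
  refine ⟨s4, (s4.tsum_le_tsum hpt s3).trans ?_⟩
  rw [((summable_sum s1).mul_left _).tsum_sub ((summable_sum s2).mul_left _), tsum_mul_left,
    tsum_mul_left, Summable.tsum_finsetSum s1, Summable.tsum_finsetSum s2]
  simp only [tsum_sq_mul_right, Finset.sum_const, Finset.card_univ, nsmul_eq_mul]
  rw [inv_mul_cancel_left₀ (Nat.cast_ne_zero.2 Fintype.card_ne_zero)]
  have : κ * (ε * ∑' g, f g ^ 2) ≤ κ * ∑ i, ∑' g, (f (g * w i) - f g) ^ 2 := by gcongr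
  linarith

/-- On a non-amenable group, the probability that the simple random walk is in a finite set decays
exponentially. -/
theorem exists_sq_wordExpect_indicator_le [Fintype ι] {w : ι → Γ}
    (hw : Subgroup.closure (Set.range w) = ⊤) {i₀ : ι} (hi₀ : w i₀ = 1)
    (hΓ : ¬ IsAmenableGroup Γ) :
    ∃ r : ℝ, 0 ≤ r ∧ r < 1 ∧ ∀ (A : Finset Γ) (n : ℕ),
      wordExpect n (fun l => (A : Set Γ).indicator 1 (l.map w).prod) ^ 2 ≤ r ^ n * A.card := by
  have : Nonempty ι := ⟨i₀⟩
  obtain ⟨ε, hε, hgap⟩ := exists_gap_of_not_isAmenableGroup hw hΓ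
  set κ : ℝ := ((Fintype.card ι : ℝ) ^ 2)⁻¹ with hκ
  have hκ0 : 0 < κ := by have := Fintype.card_pos (α := ι); positivity
  refine ⟨max 0 (1 - κ * ε), le_max_left _ _, max_lt one_pos (by nlinarith), fun A n => ?_⟩
  set r := max 0 (1 - κ * ε)
  -- Varying the starting point g gives the n-th iterate of the averaging operator on the indicator
  -- of A; its ℓ² norm bounds the value at g = 1.
  set u : ℕ → Γ → ℝ := fun n g =>
    wordExpect n (fun l => (A : Set Γ).indicator 1 (g * (l.map w).prod)) with hu
  have hsucc : ∀ n g, u (n + 1) g = 𝔼 i, u n (g * w i) := fun n g => by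
    simp [hu, wordExpect, mul_assoc]
  have hmain : ∀ n, Summable (fun g => u n g ^ 2) ∧ ∑' g, u n g ^ 2 ≤ r ^ n * A.card := fun n => by
    induction n with
    | zero =>
      have h0 : ∀ g, g ∉ A → u 0 g ^ 2 = 0 := fun g hg => by simp [hu, wordExpect, hg]
      refine ⟨summable_of_ne_finset_zero h0, ?_⟩
      rw [tsum_eq_sum h0, Finset.sum_congr rfl (g := fun _ => (1 : ℝ))]
      · simp
      · intro g hg; simp [hu, wordExpect, hg]
    | succ n ih =>
      obtain ⟨h1, h2⟩ := summable_and_tsum_sq_expect_le hi₀ ih.1 (hgap _ ih.1)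
      simp only [hsucc]
      refine ⟨h1, h2.trans ?_⟩
      rw [pow_succ' r, mul_assoc]
      exact mul_le_mul (le_max_right _ _) ih.2 (tsum_nonneg fun _ => sq_nonneg _)
        (le_max_left _ _)
  have h3 := (hmain n).1.le_tsum 1 fun _ _ => sq_nonneg _
  simp only [hu, one_mul] at h3
  exact h3.trans (hmain n).2

end SpectralGap

/-! ### Positive speed of the walk -/

theorem mem_pow_of_wordLength_le {Γ : Type*} [Group Γ] {S T : Set Γ}
    (hS : Subgroup.closure S = ⊤) (hT : S ∪ S⁻¹ ⊆ T) (hT1 : 1 ∈ T) {g : Γ} {k : ℕ}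
    (hg : wordLength S g ≤ k) : g ∈ T ^ k :=
  Set.pow_subset_pow_right hT1 hg
    (Set.pow_subset_pow_left hT (Nat.sInf_mem (exists_mem_pow_of_closure_eq_top hS g)))

/-- On a non-amenable group, the simple random walk along pairs of letters from a finite symmetric
generating set has positive speed. -/
theorem exists_wordExpect_wordLength_ge {Γ τ : Type*} [Group Γ] [Fintype τ] {S : Set Γ}
    (hS : Subgroup.closure S = ⊤) {a : τ → Γ} (ha : S ∪ S⁻¹ ⊆ Set.range a) {t₀ : τ}
    (ht₀ : a t₀ = 1) (hΓ : ¬ IsAmenableGroup Γ) :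
    ∃ L : ℕ, ∀ k : ℕ, 1 ≤ k →
      (k : ℝ) / 2 ≤ wordExpect (L * k) (fun l => (wordLength S (wordProd a l) : ℝ)) := by
  classical
  have : Nonempty τ := ⟨t₀⟩
  have hw : Subgroup.closure (Set.range fun q : τ × τ => a q.1 * a q.2) = ⊤ := by
    refine top_le_iff.1 (hS.ge.trans (Subgroup.closure_mono fun s hs => ?_))
    obtain ⟨t, rfl⟩ := ha (Or.inl hs)
    -- The identity letter matters here: without it, products of two letters might generate a proper
    -- subgroup.
    exact ⟨(t, t₀), by simp [ht₀]⟩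
  obtain ⟨r, hr0, hr1, hdecay⟩ :=
    exists_sq_wordExpect_indicator_le hw (i₀ := (t₀, t₀)) (by simp [ht₀]) hΓ
  set T : Finset Γ := Finset.univ.image a with hT
  have hTcoe : (T : Set Γ) = Set.range a := by simp [hT]
  set c : ℝ := (T.card : ℝ) with hc
  have hc0 : 0 < c := by
    rw [hc, Nat.cast_pos, Finset.card_pos]
    exact ⟨a t₀, by simp [hT]⟩
  -- L makes the decay over L steps beat the growth rate of balls, so at time L k the k-ball has
  -- probability at most 1/2.
  obtain ⟨L, hL⟩ := exists_pow_lt_of_lt_one (show 0 < 1 / (4 * c) by positivity) hr1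
  have hLc : r ^ L * c ≤ 1 / 4 := by
    calc r ^ L * c ≤ 1 / (4 * c) * c := by gcongr
      _ = 1 / 4 := by field_simp
  refine ⟨L, fun k hk => ?_⟩
  set P := wordExpect (L * k) fun l => ((T ^ k : Finset Γ) : Set Γ).indicator (1 : Γ → ℝ)
    (wordProd a l) with hP
  have hP2 : P ^ 2 ≤ (1 / 2) ^ 2 := by
    have h1 : ((T ^ k).card : ℝ) ≤ c ^ k := by
      rw [hc]; exact_mod_cast Finset.card_pow_le
    calc P ^ 2 ≤ r ^ (L * k) * (T ^ k).card := hdecay (T ^ k) (L * k)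
      _ ≤ r ^ (L * k) * c ^ k := by gcongr
      _ = (r ^ L * c) ^ k := by rw [pow_mul, mul_pow]
      _ ≤ (1 / 4) ^ k := by gcongr
      _ ≤ (1 / 4) ^ 1 := pow_le_pow_of_le_one (by norm_num) (by norm_num) hk
      _ = (1 / 2) ^ 2 := by norm_num
  have hP' : P ≤ 1 / 2 := le_of_sq_le_sq hP2 (by norm_num)
  have hpt : ∀ l : List (τ × τ), (k : ℝ) + (-k) * ((T ^ k : Finset Γ) : Set Γ).indicator
      (1 : Γ → ℝ) (wordProd a l) ≤ wordLength S (wordProd a l) := fun l => by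
    by_cases hmem : wordProd a l ∈ T ^ k
    · rw [Set.indicator_of_mem (Finset.mem_coe.2 hmem)]
      simp
    · rw [Set.indicator_of_notMem (Finset.mem_coe.not.2 hmem), mul_zero, add_zero, Nat.cast_le]
      by_contra! hlt
      have := mem_pow_of_wordLength_le hS ha ⟨t₀, ht₀⟩ hlt.le
      rw [← hTcoe, ← Finset.coe_pow, Finset.mem_coe] at this
      exact hmem this
  refine le_trans ?_ (wordExpect_mono _ hpt)
  rw [wordExpect_add, wordExpect_const, wordExpect_mul]
  nlinarith [mul_nonneg (Nat.cast_nonneg (α := ℝ) k) (sub_nonneg.2 hP')]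

/-! ### Comparison of speed and cocycle growth -/

/-- Take ε = η^(1/p) and raise to the power p; the finite exceptional set is absorbed into M. -/
theorem StrictlyDominated.exists_le_add_rpow {Γ : Type*} {f h : Γ → ℝ} {p : ℝ} (hp : 0 < p)
    (hf : ∀ g, 0 ≤ f g) (hh : ∀ g, 0 ≤ h g) (hfh : StrictlyDominated (fun g => f g ^ (1 / p)) h)
    {η : ℝ} (hη : 0 < η) : ∃ M : ℝ, ∀ g, f g ≤ M + η * h g ^ p := by
  obtain ⟨K, hK, hdom⟩ := hfh (η ^ (1 / p)) (by positivity)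
  refine ⟨∑ g ∈ hK.toFinset, f g, fun g => ?_⟩
  have hsum : 0 ≤ ∑ g ∈ hK.toFinset, f g := Finset.sum_nonneg fun g _ => hf g
  have hηp : 0 ≤ η * h g ^ p := by have := hh g; positivity
  by_cases hg : g ∈ K
  · have := Finset.single_le_sum (f := f) (fun g _ => hf g) (hK.mem_toFinset.2 hg)
    linarith
  · have hroot : ∀ x : ℝ, 0 ≤ x → (x ^ (1 / p)) ^ p = x := fun x hx => by
      rw [← Real.rpow_mul hx, one_div_mul_cancel hp.ne', Real.rpow_one]
    have h1 := Real.rpow_le_rpow (Real.rpow_nonneg (hf g) _) (hdom g hg) hp.le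
    rw [hroot _ (hf g), Real.mul_rpow (by positivity) (hh g), hroot _ hη.le] at h1
    linarith

theorem isAmenableGroup_of_cocycle_real {Γ E : Type*} [Group Γ] [NormedAddCommGroup E]
    [NormedSpace ℝ E] {S : Set Γ} (hSfin : S.Finite) (hS : Subgroup.closure S = ⊤) {p C : ℝ}
    (hE : IsPUniformlySmooth p E) (π : Γ →* Module.End ℝ E) (hπ : ∀ g v, ‖π g v‖ ≤ C * ‖v‖)
    {b : Γ → E} (hb : ∀ g h, b (g * h) = b g + π g (b h))
    (hdom : StrictlyDominated (fun g => (wordLength S g : ℝ) ^ (1 / p)) fun g => ‖b g‖) :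
    IsAmenableGroup Γ := by
  by_contra hΓ
  have hp : 1 < p := hE.1
  obtain ⟨K, hK, h2⟩ := hE.exists_two_point
  have hTfin : (S ∪ S⁻¹ ∪ {1}).Finite := (hSfin.union hSfin.inv).union (Set.finite_singleton 1)
  have : Fintype ↥(S ∪ S⁻¹ ∪ {1} : Set Γ) := hTfin.fintype
  have hmem : ∀ x : Γ, x ∈ S ∪ S⁻¹ ∪ {1} ↔ x⁻¹ ∈ S ∪ S⁻¹ ∪ {1} := fun x => by
    simp only [Set.mem_union, Set.mem_inv, Set.mem_singleton_iff, inv_inv, inv_eq_one]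
    tauto
  set inv : ↥(S ∪ S⁻¹ ∪ {1} : Set Γ) ≃ ↥(S ∪ S⁻¹ ∪ {1} : Set Γ) :=
    (Equiv.inv Γ).subtypeEquiv hmem
  set t₀ : ↥(S ∪ S⁻¹ ∪ {1} : Set Γ) := ⟨1, Or.inr rfl⟩
  have : Nonempty ↥(S ∪ S⁻¹ ∪ {1} : Set Γ) := ⟨t₀⟩
  obtain ⟨L, hL⟩ := exists_wordExpect_wordLength_ge hS
    (a := fun t : ↥(S ∪ S⁻¹ ∪ {1} : Set Γ) => (t : Γ))
    (by rw [Subtype.range_coe]; exact Set.subset_union_left) (t₀ := t₀) rfl hΓ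
  obtain ⟨D, hD, hmoment⟩ := exists_wordExpect_cocycle_le π hp.le hK hπ h2 hb (inv := inv)
    (a := fun t : ↥(S ∪ S⁻¹ ∪ {1} : Set Γ) => (t : Γ)) fun t => rfl
  -- At time L k this leaves k/2 ≤ M + k/4, false once k > 4M; the + 1 guards against D L = 0.
  set η : ℝ := 1 / (4 * (D * L + 1)) with hη
  have hηpos : 0 < η := by positivity
  have hηDL : η * (D * L) ≤ 1 / 4 := by
    rw [hη, one_div, inv_mul_le_iff₀ (by positivity)]
    linarith
  obtain ⟨M, hM⟩ := hdom.exists_le_add_rpow (zero_lt_one.trans hp) (fun g => Nat.cast_nonneg _)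
    (fun g => norm_nonneg _) hηpos
  obtain ⟨k, hk⟩ := exists_nat_gt (max (4 * M) 1)
  have hk1 : 1 ≤ k := by
    have := (le_max_right _ _).trans_lt hk
    exact_mod_cast this.le
  have hkM := (le_max_left _ _).trans_lt hk
  have hupper := (hL k hk1).trans (wordExpect_mono _ fun l => hM _)
  rw [wordExpect_add, wordExpect_const, wordExpect_mul] at hupper
  have h3 := mul_le_mul_of_nonneg_left (hmoment (L * k)) hηpos.le
  have h4 : η * (D * ((L * k : ℕ) : ℝ)) ≤ 1 / 4 * k := by
    calc _ = η * (D * L) * k := by push_cast; ring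
      _ ≤ _ := by gcongr
  linarith

theorem isAmenableGroup_of_cocycle {Γ 𝕜 B : Type*} [Group Γ] [RCLike 𝕜] [NormedAddCommGroup B]
    [NormedSpace 𝕜 B] {S : Set Γ} (hSfin : S.Finite) (hS : Subgroup.closure S = ⊤) {p : ℝ}
    (hB : IsPUniformlySmooth p B) {π : Γ →* (B ≃L[𝕜] B)} (hπ : IsUniformlyBoundedRep π)
    {b : Γ → B} (hb : IsCocycle π b)
    (hdom : StrictlyDominated (fun g => (wordLength S g : ℝ) ^ (1 / p)) fun g => ‖b g‖) :
    IsAmenableGroup Γ := by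
  obtain ⟨C, hC⟩ := hπ
  -- Smoothness depends only on the norm, so forgetting the complex structure loses nothing.
  let _ : NormedSpace ℝ B := NormedSpace.restrictScalars ℝ 𝕜 B
  let π' : Γ →* Module.End ℝ B :=
    { toFun := fun g =>
        { toFun := π g
          map_add' := map_add (π g)
          map_smul' := fun c v => map_smul (π g) (algebraMap ℝ 𝕜 c) v }
      map_one' := by ext v; simp only [map_one]; rfl
      map_mul' := fun g h => by ext v; simp only [map_mul]; rfl }
  exact isAmenableGroup_of_cocycle_real hSfin hS hB π'
    (fun g v => (π g : B →L[𝕜] B).le_of_opNorm_le (hC g) v) hb hdom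

theorem theorem1p2 {Γ : Type*} [Group Γ] (S : Set Γ) (hSfin : S.Finite)
    (hSgen : Subgroup.closure S = ⊤) :
    (∀ {𝕜 B : Type*} [RCLike 𝕜] [NormedAddCommGroup B] [NormedSpace 𝕜 B] [CompleteSpace B]
        (p : ℝ) (π : Γ →* (B ≃L[𝕜] B)) (b : Γ → B),
        IsPUniformlySmooth p B → IsUniformlyBoundedRep π → IsCocycle π b →
        StrictlyDominated (fun g => (wordLength S g : ℝ) ^ (1 / p)) (fun g => ‖b g‖) →
        IsAmenableGroup Γ) ∧
    (¬ IsAmenableGroup Γ →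
      ∀ {𝕜 H : Type*} [RCLike 𝕜] [NormedAddCommGroup H] [InnerProductSpace 𝕜 H] [CompleteSpace H]
        (π : Γ →* (H ≃L[𝕜] H)) (b : Γ → H),
        IsUniformlyBoundedRep π → IsCocycle π b →
        ¬ StrictlyDominated (fun g => (wordLength S g : ℝ) ^ (1 / 2 : ℝ)) (fun g => ‖b g‖)) := by
  refine ⟨fun p π b hB hπ hb hdom => isAmenableGroup_of_cocycle hSfin hSgen hB hπ hb hdom, ?_⟩
  intro hΓ 𝕜 H _ _ _ _ π b hπ hb hdom
  exact hΓ (isAmenableGroup_of_cocycle hSfin hSgen (isPUniformlySmooth_two 𝕜) hπ hb hdom)
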